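/- Let $c\in\mathbb{C}^2$ be arbitrary and write $\Delta_c f(z)=f(z+c)-f(z)$ for $f:\mathbb{C}^2\to\mathbb{C}$. Then there is no pair $(f_1,f_2)$ of functions $\mathbb{C}^2\to\mathbb{C}$ such that each of $f_1$ and $f_2$ is a transcendental entire function (that is, holomorphic on $\mathbb{C}^2$ and not a polynomial) of finite order and $$f_1(z)^2+(\Delta_c f_2(z))^2=1,\qquad f_2(z)^2+(\Delta_c f_1(z))^2=1\qquad\text{for all } z\in\mathbb{C}^2 .$$ Here the order of an entire function $f$ on $\mathbb{C}^2$ is $$\limsup_{r\to\infty}\frac{\log^+\log^+ M(r,f)}{\log r}\in[0,\infty],\qquad M(r,f)=\max_{|z|\le r}|f(z)|,$$ with $|z|$ the Euclidean norm and $\log^+x=\max(\log x,0)$, $\log^+0=0$. -/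

import Mathlib

/-- Complex Euclidean space `ℂ²`, with the norm `|z| = (|z₁|² + |z₂|²)^{1/2}`. -/
abbrev CTwo : Type := EuclideanSpace ℂ (Fin 2)

/-- The difference operator `Δ_c f (z) = f (z + c) - f z`. -/
def differenceOp (c : CTwo) (f : CTwo → ℂ) (z : CTwo) : ℂ := f (z + c) - f z

/-- A function `f : ℂ² → ℂ` is a polynomial function of the two coordinates. -/
def IsPolynomialFunction (f : CTwo → ℂ) : Prop :=
  ∃ P : MvPolynomial (Fin 2) ℂ, ∀ z : CTwo, f z = MvPolynomial.eval (fun i => z i) P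

/-- A transcendental entire function on `ℂ²`: holomorphic on all of `ℂ²` and not a polynomial. -/
def IsTranscendentalEntire (f : CTwo → ℂ) : Prop :=
  Differentiable ℂ f ∧ ¬ IsPolynomialFunction f

/-- The maximum modulus `M(r, f) = max {|f z| : |z| ≤ r}` (a genuine maximum when `f` is
continuous and `r ≥ 0`). -/
noncomputable def maxModulus (f : CTwo → ℂ) (r : ℝ) : ℝ :=
  sSup ((fun z => ‖f z‖) '' Metric.closedBall (0 : CTwo) r)

/-- The order of growth `limsup_{r → ∞} log⁺ log⁺ M(r, f) / log r` of an entire function `f`,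
an extended real number. -/
noncomputable def growthOrder (f : CTwo → ℂ) : EReal :=
  Filter.limsup
    (fun r : ℝ => ((Real.posLog (Real.posLog (maxModulus f r)) / Real.log r : ℝ) : EReal))
    Filter.atTop

/-- `f` has finite order. -/
def HasFiniteOrder (f : CTwo → ℂ) : Prop := growthOrder f < ⊤

/-! Restrict to the complex lines `t ↦ w + t • c`, on which the shift by `c` becomes `t ↦ t + 1`.
There each equation factors as `(g + iΔk)(g - iΔk) = 1`, so by Hadamard's argument
(Borel–Carathéodory and Cauchy estimates) `g₁ = cosh p`, `iΔg₂ = sinh p`, `g₂ = cosh q`, `iΔg₁ =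
sinh q` with polynomials `p`, `q`. If neither is constant, Borel's theorem on exponential sums,
`coeff_eq_zero_of_sum_exp_eq_zero`, forces `p(z + 1) = p(z) + a` and `q = ±p + b`; comparing
coefficients gives incompatible equations for `e^a` and `e^b`. If one is constant, a difference term
vanishes and `g₁² = 1` follows. Hence `f₁² = 1` on all of `ℂ²`, so `f₁` is constant by
connectedness, and not transcendental. -/

/-! ### Entire functions of one variable -/

/-- A zero-free entire function has an entire logarithm. -/
theorem exists_entire_log {h : ℂ → ℂ} (hd : Differentiable ℂ h) (h0 : ∀ z, h z ≠ 0) :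
    ∃ p : ℂ → ℂ, Differentiable ℂ p ∧ ∀ z, h z = Complex.exp (p z) := by
  have hq : Differentiable ℂ (fun z => deriv h z / h z) := hd.deriv.div hd h0
  obtain ⟨p, hp0, hp⟩ := (Complex.IsConservativeOn.isExactOn_univ hq.continuous
    hq.differentiableOn.isConservativeOn).with_val_at 0 (Complex.log (h 0))
  have hp' : ∀ z, HasDerivAt p (deriv h z / h z) z := fun z => hp z (Set.mem_univ z)
  have hpd : Differentiable ℂ p := fun z => (hp' z).differentiableAt
  refine ⟨p, hpd, fun z => ?_⟩
  have hder : ∀ w, HasDerivAt (fun w => h w * Complex.exp (-p w)) 0 w := fun w => by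
    have := (hd w).hasDerivAt.mul (hp' w).neg.cexp
    convert! this using 1
    field_simp [h0 w]
    ring
  have hc := is_const_of_deriv_eq_zero (fun w => (hder w).differentiableAt)
    (fun w => (hder w).deriv) z 0
  simp only [hp0, Complex.exp_neg, Complex.exp_log (h0 0)] at hc
  have he := Complex.exp_ne_zero (p z)
  rw [mul_inv_cancel₀ (h0 0)] at hc
  field_simp at hc
  exact hc

/-- An entire function of polynomial growth is a polynomial. -/
theorem exists_polynomial_of_growth {f : ℂ → ℂ} (hf : Differentiable ℂ f) (C : ℝ) (N : ℕ)
    (hb : ∀ᶠ r : ℝ in Filter.atTop, ∀ z, ‖z‖ ≤ r → ‖f z‖ ≤ C * r ^ N) :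
    ∃ P : Polynomial ℂ, ∀ z, f z = P.eval z := by
  have hz : ∀ n, N < n → iteratedDeriv n f 0 = 0 := by
    intro n hn
    obtain ⟨k, rfl⟩ := Nat.exists_eq_add_of_lt hn
    -- Cauchy's estimate gives `n! |C| r^(-k-1)`, weakened to `n! |C| r⁻¹` for `r ≥ 1`.
    have hlim : Filter.Tendsto (fun r : ℝ => ((N + k + 1).factorial * |C|) * r⁻¹)
        Filter.atTop (nhds 0) := by
      simpa using tendsto_inv_atTop_zero.const_mul ((N + k + 1).factorial * |C| : ℝ)
    refine norm_le_zero_iff.mp (ge_of_tendsto hlim ?_)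
    filter_upwards [hb, Filter.eventually_ge_atTop 1] with r hr h1
    have hr0 : 0 < r := by linarith
    refine (Complex.norm_iteratedDeriv_le_of_forall_mem_sphere_norm_le (C := |C| * r ^ N) _ hr0
      hf.diffContOnCl fun z hz => ?_).trans ?_
    · refine (hr z (by simpa using (mem_sphere_zero_iff_norm.mp hz).le)).trans ?_
      gcongr
      exact le_abs_self C
    · have hk : r ^ (N + k + 1) = r ^ N * (r ^ k * r) := by ring
      rw [hk, div_le_iff₀ (by positivity)]
      have h2 : ((N + k + 1).factorial * |C|) * r⁻¹ * (r ^ N * (r ^ k * r))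
          = (N + k + 1).factorial * (|C| * r ^ N) * r ^ k := by field_simp
      rw [h2]
      exact le_mul_of_one_le_right (by positivity) (one_le_pow₀ h1)
  refine ⟨∑ n ∈ Finset.range (N + 1),
    Polynomial.monomial n ((n.factorial : ℂ)⁻¹ * iteratedDeriv n f 0), fun z => ?_⟩
  rw [← Complex.taylorSeries_eq_of_entire' 0 z hf,
    tsum_eq_sum (s := Finset.range (N + 1)), Polynomial.eval_finsetSum]
  · simp
  · intro n hn
    rw [hz n (by simpa [Nat.lt_succ_iff] using hn)]
    simp

/-! ### Growth of finite order -/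

/-- `f` is eventually bounded by `exp (r ^ N)` on the ball of radius `r`, for some `N`. -/
def HasExpPowGrowth {E : Type*} [Norm E] (f : E → ℂ) : Prop :=
  ∃ N : ℕ, ∀ᶠ r : ℝ in Filter.atTop, ∀ z, ‖z‖ ≤ r → ‖f z‖ ≤ Real.exp (r ^ N)

/-- A zero-free entire function of finite order is the exponential of a polynomial. -/
theorem exists_eq_exp_polynomial {h : ℂ → ℂ} (hd : Differentiable ℂ h) (h0 : ∀ z, h z ≠ 0)
    (hg : HasExpPowGrowth h) :
    ∃ P : Polynomial ℂ, ∀ z, h z = Complex.exp (P.eval z) := by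
  obtain ⟨p, hp, hhp⟩ := exists_entire_log hd h0
  obtain ⟨N, hN⟩ := hg
  suffices ∃ P : Polynomial ℂ, ∀ z, p z = P.eval z by
    obtain ⟨P, hP⟩ := this
    exact ⟨P, fun z => by rw [hhp, hP]⟩
  -- Borel–Carathéodory on the disc of radius `2r`, where `Re p = log |h| ≤ (2r)^N`. For `|z| ≤ r`
  -- its two quotients are at most `1` and `3`.
  refine exists_polynomial_of_growth hp (2 * 2 ^ N + 3 * ‖p 0‖) N ?_
  have hN2 := (Filter.tendsto_id.const_mul_atTop (by norm_num : (0 : ℝ) < 2)).eventually hN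
  filter_upwards [hN2, Filter.eventually_ge_atTop 1] with r hr h1 z hz
  have hr0 : 0 < r := by linarith
  simp only [id] at hr
  have hmaps : Set.MapsTo p (Metric.ball 0 (2 * r)) {w | w.re ≤ (2 * r) ^ N} := by
    intro w hw
    have := hr w (mem_ball_zero_iff.mp hw).le
    rw [hhp, Complex.norm_exp, Real.exp_le_exp] at this
    exact this
  have hBC := Complex.borelCaratheodory (z := z) (by positivity : 0 < (2 * r) ^ N)
    hp.differentiableOn hmaps (by positivity) (by simp; linarith)
  refine hBC.trans ?_
  have hd0 : 0 < 2 * r - ‖z‖ := by linarith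
  have e1 : 2 * (2 * r) ^ N * ‖z‖ / (2 * r - ‖z‖) ≤ 2 * (2 * r) ^ N := by
    rw [div_le_iff₀ hd0]
    gcongr
    linarith
  have e2 : ‖p 0‖ * (2 * r + ‖z‖) / (2 * r - ‖z‖) ≤ 3 * ‖p 0‖ := by
    rw [div_le_iff₀ hd0]
    nlinarith [norm_nonneg (p 0)]
  have e3 : 3 * ‖p 0‖ ≤ 3 * ‖p 0‖ * r ^ N :=
    le_mul_of_one_le_right (by positivity) (one_le_pow₀ h1)
  rw [mul_pow] at e1 ⊢
  nlinarith

/-- A function of finite order has `exp (r ^ N)` growth. -/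
theorem HasFiniteOrder.hasExpPowGrowth {f : CTwo → ℂ} (hf : Continuous f)
    (h : HasFiniteOrder f) : HasExpPowGrowth f := by
  obtain ⟨x, hx, -⟩ := EReal.lt_iff_exists_real_btwn.mp h
  obtain ⟨N, hN⟩ := exists_nat_ge x
  refine ⟨N, ?_⟩
  filter_upwards [Filter.eventually_lt_of_limsup_lt hx, Filter.eventually_gt_atTop 1]
    with r hr h1 z hz
  have hr0 : 0 < r := by linarith
  have hlog : 0 < Real.log r := Real.log_pos h1
  have le_exp : ∀ a b : ℝ, Real.posLog a ≤ b → a ≤ Real.exp b := fun a b hab => by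
    rcases le_or_gt a 0 with ha | ha
    · exact ha.trans (Real.exp_pos b).le
    · exact (Real.log_le_iff_le_exp ha).mp ((le_max_right _ _).trans hab)
  rw [EReal.coe_lt_coe_iff, div_lt_iff₀ hlog] at hr
  have hr2 : Real.posLog (Real.posLog (maxModulus f r)) ≤ Real.log (r ^ N) := by
    rw [Real.log_pow]
    exact hr.le.trans (by gcongr)
  have h2 := le_exp _ _ (le_exp _ _ hr2)
  rw [Real.exp_log (by positivity)] at h2
  refine le_trans ?_ h2
  exact le_csSup ((isCompact_closedBall (0 : CTwo) r).image hf.norm).bddAbove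
    ⟨z, by simpa using hz, rfl⟩

/-- Criterion for `exp (r ^ N)` growth with arbitrary constants. -/
theorem HasExpPowGrowth.of_le {E : Type*} [Norm E] {f : E → ℂ} (C : ℝ) (N : ℕ)
    (h : ∀ᶠ r : ℝ in Filter.atTop, ∀ z, ‖z‖ ≤ r → ‖f z‖ ≤ Real.exp (C + C * r ^ N)) :
    HasExpPowGrowth f := by
  refine ⟨N + 1, ?_⟩
  -- The constants are absorbed by one more power: `C + C r^N ≤ 2|C| r^N ≤ r^(N+1)`.
  filter_upwards [h, Filter.eventually_ge_atTop 1, Filter.eventually_ge_atTop (2 * |C|)]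
    with r hr h1 h2 z hz
  refine (hr z hz).trans (Real.exp_le_exp.mpr ?_)
  have hp : 1 ≤ r ^ N := one_le_pow₀ h1
  have hC := le_abs_self C
  have hC0 := abs_nonneg C
  rw [pow_succ]
  nlinarith [mul_le_mul_of_nonneg_right hC (by positivity : 0 ≤ r ^ N)]

theorem HasExpPowGrowth.comp {E F : Type*} [Norm E] [SeminormedAddCommGroup F] {f : E → ℂ}
    (hf : HasExpPowGrowth f) {φ : F → E} (A K : ℝ) (hK : 0 < K)
    (hφ : ∀ z, ‖φ z‖ ≤ A + K * ‖z‖) : HasExpPowGrowth (fun z => f (φ z)) := by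
  obtain ⟨N, hN⟩ := hf
  refine .of_le ((K + 1) ^ N) N ?_
  -- Once `r ≥ A`, the radius `(K + 1) r` exceeds `A + K r`.
  have h1 := (Filter.tendsto_id.const_mul_atTop (by positivity : 0 < K + 1)).eventually hN
  filter_upwards [h1, Filter.eventually_ge_atTop A] with r hr hA z hz
  simp only [id] at hr
  refine (hr (φ z) ?_).trans (Real.exp_le_exp.mpr ?_)
  · nlinarith [hφ z]
  · rw [mul_pow]
    exact le_add_of_nonneg_left (by positivity)

theorem HasExpPowGrowth.const_mul {E : Type*} [Norm E] {f : E → ℂ}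
    (hf : HasExpPowGrowth f) (a : ℂ) : HasExpPowGrowth (fun z => a * f z) := by
  obtain ⟨N, hN⟩ := hf
  refine .of_le (‖a‖ + 1) N ?_
  filter_upwards [hN, Filter.eventually_ge_atTop 0] with r hr h0 z hz
  rw [norm_mul, Real.exp_add]
  have hp : 0 ≤ r ^ N := by positivity
  gcongr
  · linarith [Real.add_one_le_exp (‖a‖ + 1)]
  · exact (hr z hz).trans (Real.exp_le_exp.mpr (by nlinarith [norm_nonneg a]))

theorem HasExpPowGrowth.add {E : Type*} [Norm E] {f g : E → ℂ}
    (hf : HasExpPowGrowth f) (hg : HasExpPowGrowth g) :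
    HasExpPowGrowth (fun z => f z + g z) := by
  obtain ⟨N, hN⟩ := hf
  obtain ⟨M, hM⟩ := hg
  refine .of_le 1 (max N M) ?_
  filter_upwards [hN, hM, Filter.eventually_ge_atTop 1] with r hr hr' h1 z hz
  have e1 : Real.exp (r ^ N) ≤ Real.exp (r ^ max N M) :=
    Real.exp_le_exp.mpr (pow_le_pow_right₀ h1 (le_max_left _ _))
  have e2 : Real.exp (r ^ M) ≤ Real.exp (r ^ max N M) :=
    Real.exp_le_exp.mpr (pow_le_pow_right₀ h1 (le_max_right _ _))
  have e3 : (1 + 1) * Real.exp (r ^ max N M) ≤ Real.exp 1 * Real.exp (r ^ max N M) := by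
    gcongr
    exact Real.add_one_le_exp 1
  rw [one_mul, Real.exp_add]
  linarith [norm_add_le (f z) (g z), hr z hz, hr' z hz]

/-! ### Exponential sums with polynomial exponents -/

namespace Polynomial

/-- The operator `a ↦ a' + R' a`, that is `a ↦ e^{-R} (a e^R)'`, on polynomials. -/
noncomputable def twistedDerivative (R a : ℂ[X]) : ℂ[X] := derivative a + derivative R * a

theorem hasDerivAt_mul_exp (R a : ℂ[X]) (z : ℂ) :
    HasDerivAt (fun z => a.eval z * Complex.exp (R.eval z))
      ((twistedDerivative R a).eval z * Complex.exp (R.eval z)) z := by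
  convert! (a.hasDerivAt z).mul (R.hasDerivAt z).cexp using 1
  simp only [twistedDerivative, eval_add, eval_mul]
  ring

/-- For `a ≠ 0`, `a'` has smaller degree than `R' a`, so the two cannot cancel. -/
theorem eq_zero_of_twistedDerivative_eq_zero {R a : ℂ[X]} (hR : derivative R ≠ 0)
    (h : twistedDerivative R a = 0) : a = 0 := by
  by_contra ha
  have h1 : (derivative a).degree < (derivative R * a).degree :=
    (degree_derivative_lt ha).trans_le (by
      rw [degree_mul]
      exact le_add_of_nonneg_left (zero_le_degree_iff.mpr hR))
  have h2 := degree_add_eq_right_of_degree_lt h1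
  rw [twistedDerivative] at h
  rw [h, degree_zero, eq_comm, degree_eq_bot] at h2
  exact mul_ne_zero hR ha h2

theorem eq_zero_of_iterate_twistedDerivative_eq_zero {R a : ℂ[X]} (hR : derivative R ≠ 0) (k : ℕ)
    (h : (twistedDerivative R)^[k] a = 0) : a = 0 := by
  induction k generalizing a with
  | zero => simpa using h
  | succ k ih =>
    rw [Function.iterate_succ_apply] at h
    exact eq_zero_of_twistedDerivative_eq_zero hR (ih h)

theorem iterate_twistedDerivative_eq_zero (a : ℂ[X]) :
    (twistedDerivative 0)^[a.natDegree + 1] a = 0 := by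
  have : twistedDerivative 0 = derivative := by
    funext a
    simp [twistedDerivative]
  rw [this]
  exact iterate_derivative_eq_zero (Nat.lt_succ_self _)

theorem sum_iterate_twistedDerivative_eq_zero {ι : Type*} (s : Finset ι) (a R : ι → ℂ[X])
    (h : ∀ z, ∑ i ∈ s, (a i).eval z * Complex.exp ((R i).eval z) = 0) (k : ℕ) :
    ∀ z, ∑ i ∈ s, ((twistedDerivative (R i))^[k] (a i)).eval z * Complex.exp ((R i).eval z)
      = 0 := by
  induction k with
  | zero => simpa using h
  | succ k ih =>
    intro z
    have h1 := HasDerivAt.fun_sum fun i (_ : i ∈ s) =>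
      hasDerivAt_mul_exp (R i) ((twistedDerivative (R i))^[k] (a i)) z
    simp only [ih] at h1
    simp only [Function.iterate_succ_apply']
    exact h1.unique (hasDerivAt_const z 0)

/-- **Borel's theorem** on exponential sums, for polynomial exponents: in a vanishing sum
`∑ aᵢ exp Pᵢ`, the coefficient of an exponential whose exponent differs from all others by a
nonconstant polynomial vanishes. -/
theorem coeff_eq_zero_of_sum_exp_eq_zero {ι : Type*} [DecidableEq ι] (s : Finset ι)
    (a P : ι → ℂ[X]) {i : ι} (hi : i ∈ s)
    (hP : ∀ j ∈ s, j ≠ i → derivative (P j) ≠ derivative (P i))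
    (h : ∀ z, ∑ j ∈ s, (a j).eval z * Complex.exp ((P j).eval z) = 0) : a i = 0 := by
  induction hn : s.card generalizing s a P with
  | zero => simp_all
  | succ n ih =>
    by_cases hs : ∃ j ∈ s, j ≠ i
    · obtain ⟨m, hm, hmi⟩ := hs
      -- Dividing by `exp P_m` makes the `m`-th term a polynomial, which `deg a_m + 1`
      -- differentiations kill. The `i`-th coefficient can only become zero if it was zero, since `P
      -- i - P m` is nonconstant.
      have h1 : ∀ z, ∑ j ∈ s, (a j).eval z * Complex.exp ((P j - P m).eval z) = 0 := fun z => by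
        simp only [eval_sub, Complex.exp_sub, mul_div_assoc', ← Finset.sum_div, h, zero_div]
      have h2 := sum_iterate_twistedDerivative_eq_zero s a (fun j => P j - P m) h1
        ((a m).natDegree + 1)
      have hR : derivative (P i - P m) ≠ 0 := by
        rw [derivative_sub, sub_ne_zero]
        exact (hP m hm hmi).symm
      refine eq_zero_of_iterate_twistedDerivative_eq_zero hR ((a m).natDegree + 1) ?_
      refine ih (s.erase m) (fun j => (twistedDerivative (P j - P m))^[(a m).natDegree + 1] (a j))
        (fun j => P j - P m) (Finset.mem_erase.mpr ⟨hmi.symm, hi⟩) ?_ ?_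
        (by rw [Finset.card_erase_of_mem hm, hn]; rfl)
      · intro j hj hji
        simpa [derivative_sub] using hP j (Finset.mem_of_mem_erase hj) hji
      · intro z
        rw [← h2 z, ← Finset.add_sum_erase _ _ hm]
        simp only [sub_self, iterate_twistedDerivative_eq_zero, eval_zero, zero_mul, zero_add]
    · push Not at hs
      have hsi : s = {i} := Finset.eq_singleton_iff_unique_mem.mpr ⟨hi, hs⟩
      refine funext fun z => ?_
      simpa [hsi, Complex.exp_ne_zero] using h z

/-- Two exponentials of polynomials whose difference is nonconstant are linearly independent. -/
theorem eq_zero_of_add_exp_eq_zero {P Q : ℂ[X]} (h : derivative P ≠ derivative Q) {α β : ℂ}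
    (hs : ∀ z, α * Complex.exp (P.eval z) + β * Complex.exp (Q.eval z) = 0) :
    α = 0 ∧ β = 0 := by
  have h1 : ∀ z, ∑ j : Fin 2, (![C α, C β] j).eval z * Complex.exp ((![P, Q] j).eval z) = 0 :=
    fun z => by simpa [Fin.sum_univ_two] using hs z
  constructor
  · have := coeff_eq_zero_of_sum_exp_eq_zero Finset.univ _ _ (Finset.mem_univ (0 : Fin 2))
      (by simp [Fin.forall_fin_two, h.symm]) h1
    simpa using this
  · have := coeff_eq_zero_of_sum_exp_eq_zero Finset.univ _ _ (Finset.mem_univ (1 : Fin 2))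
      (by simp [Fin.forall_fin_two, h]) h1
    simpa using this

/-- In a vanishing combination of six exponentials, the exponent of a term with nonzero
coefficient differs from another exponent by a constant. -/
theorem derivative_mem_of_sum_six_exp_eq_zero {P₀ P₁ P₂ P₃ P₄ P₅ : ℂ[X]}
    {a₀ a₁ a₂ a₃ a₄ a₅ : ℂ} (h0 : a₀ ≠ 0)
    (hs : ∀ z, a₀ * Complex.exp (P₀.eval z) + a₁ * Complex.exp (P₁.eval z)
      + a₂ * Complex.exp (P₂.eval z) + a₃ * Complex.exp (P₃.eval z)
      + a₄ * Complex.exp (P₄.eval z) + a₅ * Complex.exp (P₅.eval z) = 0) :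
    derivative P₁ = derivative P₀ ∨ derivative P₂ = derivative P₀ ∨
      derivative P₃ = derivative P₀ ∨ derivative P₄ = derivative P₀ ∨
      derivative P₅ = derivative P₀ := by
  by_contra! hne
  obtain ⟨h1, h2, h3, h4, h5⟩ := hne
  have key := coeff_eq_zero_of_sum_exp_eq_zero Finset.univ
    ![C a₀, C a₁, C a₂, C a₃, C a₄, C a₅] ![P₀, P₁, P₂, P₃, P₄, P₅] (Finset.mem_univ (0 : Fin 6))
    (fun j _ hj => by fin_cases j <;> simp_all) (fun z => by simpa [Fin.sum_univ_six] using hs z)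
  exact h0 (by simpa using key)

/-- Translation preserves the leading coefficient, negation reverses its sign. -/
theorem taylor_ne_neg {u : ℂ[X]} (hu : u ≠ 0) (r : ℂ) : taylor r u ≠ -u := by
  intro h
  have := congrArg leadingCoeff h
  rw [leadingCoeff_taylor, leadingCoeff_neg, self_eq_neg, leadingCoeff_eq_zero] at this
  exact hu this

theorem exists_eval_eq_add_of_derivative_eq {P Q : ℂ[X]} (h : derivative P = derivative Q) :
    ∃ a : ℂ, ∀ z, P.eval z = Q.eval z + a := by
  have h0 : derivative (P - Q) = 0 := by rw [derivative_sub, h, sub_self]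
  refine ⟨(P - Q).coeff 0, fun z => ?_⟩
  have := congrArg (eval z) (eq_C_of_derivative_eq_zero h0)
  rw [eval_sub, eval_C] at this
  linear_combination this

end Polynomial

/-! ### The one-variable system -/

open Polynomial in
/-- The polynomial exponents `p`, `q` with `Δ cosh p = -i sinh q`, `Δ cosh q = -i sinh p`
cannot both be nonconstant. -/
theorem not_exists_polynomial_exponents {p q : ℂ[X]} (hp : derivative p ≠ 0)
    (hq : derivative q ≠ 0)
    (h₁ : ∀ z, Complex.exp (p.eval (z + 1)) + Complex.exp (-p.eval (z + 1))
      - Complex.exp (p.eval z) - Complex.exp (-p.eval z)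
      + Complex.I * Complex.exp (q.eval z) - Complex.I * Complex.exp (-q.eval z) = 0)
    (h₂ : ∀ z, Complex.exp (q.eval (z + 1)) + Complex.exp (-q.eval (z + 1))
      - Complex.exp (q.eval z) - Complex.exp (-q.eval z)
      + Complex.I * Complex.exp (p.eval z) - Complex.I * Complex.exp (-p.eval z) = 0) :
    False := by
  have hdt : derivative (taylor 1 p) = taylor 1 (derivative p) := by
    simp [taylor_apply, derivative_comp]
  have hneg : ∀ u : ℂ[X], u ≠ 0 → -u ≠ u := fun u hu h => hu (neg_eq_self.mp h)
  have hu1 := taylor_ne_neg hp 1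
  have hu2 : taylor 1 (derivative p) ≠ 0 := by rwa [Ne, taylor_eq_zero]
  -- One identity is used three times, isolating in turn the exponents `p(z + 1)`, `p` and `q`.
  have r1 := derivative_mem_of_sum_six_exp_eq_zero (P₀ := taylor 1 p) (P₁ := -taylor 1 p)
    (P₂ := p) (P₃ := -p) (P₄ := q) (P₅ := -q) (a₀ := 1) (a₁ := 1) (a₂ := -1) (a₃ := -1)
    (a₄ := Complex.I) (a₅ := -Complex.I) one_ne_zero (fun z => by
      simp only [taylor_eval, eval_neg]; linear_combination h₁ z)
  have r2 := derivative_mem_of_sum_six_exp_eq_zero (P₀ := p) (P₁ := -taylor 1 p)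
    (P₂ := taylor 1 p) (P₃ := -p) (P₄ := q) (P₅ := -q) (a₀ := -1) (a₁ := 1) (a₂ := 1) (a₃ := -1)
    (a₄ := Complex.I) (a₅ := -Complex.I) (by norm_num) (fun z => by
      simp only [taylor_eval, eval_neg]; linear_combination h₁ z)
  have r3 := derivative_mem_of_sum_six_exp_eq_zero (P₀ := q) (P₁ := -taylor 1 p)
    (P₂ := taylor 1 p) (P₃ := -p) (P₄ := p) (P₅ := -q) (a₀ := Complex.I) (a₁ := 1) (a₂ := 1)
    (a₃ := -1) (a₄ := -1) (a₅ := -Complex.I) Complex.I_ne_zero (fun z => by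
      simp only [taylor_eval, eval_neg]; linear_combination h₁ z)
  simp only [derivative_neg, hdt] at r1 r2 r3
  have n1 := hneg _ hp
  have n2 := hneg _ hq
  have n3 := hneg _ hu2
  -- If `p'(z + 1) ≠ p'`, then `r1` and `r2` make `q'` equal to both `±p'(z + 1)` and `±p'`, so
  -- `p'(z + 1) = -p'`, which `hu1` excludes.
  obtain ⟨hpp, hqp⟩ : taylor 1 (derivative p) = derivative p ∧
      (derivative q = derivative p ∨ derivative q = derivative (-p)) := by
    rw [derivative_neg]
    grind
  obtain ⟨a, ha⟩ := exists_eval_eq_add_of_derivative_eq (hdt.trans hpp)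
  simp only [taylor_eval] at ha
  have hI := Complex.I_mul_I
  have hAe := Complex.exp_ne_zero a
  have hind : derivative p ≠ derivative (-p) := by
    rw [derivative_neg]; exact n1.symm
  rcases hqp with hqp | hqp <;> obtain ⟨b, hb⟩ := exists_eval_eq_add_of_derivative_eq hqp
  · have hBe := Complex.exp_ne_zero b
    simp only [hb, ha, Complex.exp_add, neg_add, Complex.exp_neg] at h₁ h₂
    obtain ⟨e1, e2⟩ := eq_zero_of_add_exp_eq_zero hind
      (α := Complex.exp a - 1 + Complex.I * Complex.exp b)
      (β := (Complex.exp a)⁻¹ - 1 - Complex.I * (Complex.exp b)⁻¹) fun z => by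
        rw [eval_neg, Complex.exp_neg]; linear_combination h₁ z
    obtain ⟨e3, -⟩ := eq_zero_of_add_exp_eq_zero hind
      (α := Complex.exp a * Complex.exp b - Complex.exp b + Complex.I)
      (β := (Complex.exp a)⁻¹ * (Complex.exp b)⁻¹ - (Complex.exp b)⁻¹ - Complex.I) fun z => by
        rw [eval_neg, Complex.exp_neg]; linear_combination h₂ z
    generalize Complex.exp a = A at *
    generalize Complex.exp b = B at *
    field_simp at e2
    -- `e1` and `e3` give `B² = 1`, `e1` and `e2` give `A = B²`; then `e1` reads `iB = 0`.
    have hB2 : B ^ 2 = 1 := by grind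
    have hA : A = 1 := by grind
    grind
  · have hBe := Complex.exp_ne_zero b
    simp only [hb, ha, Complex.exp_add, neg_add, Complex.exp_neg, eval_neg, neg_neg]
      at h₁ h₂
    obtain ⟨e1, e2⟩ := eq_zero_of_add_exp_eq_zero hind
      (α := Complex.exp a - 1 - Complex.I * (Complex.exp b)⁻¹)
      (β := (Complex.exp a)⁻¹ - 1 + Complex.I * Complex.exp b) fun z => by
        rw [eval_neg, Complex.exp_neg]; linear_combination h₁ z
    obtain ⟨e3, -⟩ := eq_zero_of_add_exp_eq_zero hind
      (α := Complex.exp a * (Complex.exp b)⁻¹ - (Complex.exp b)⁻¹ + Complex.I)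
      (β := (Complex.exp a)⁻¹ * Complex.exp b - Complex.exp b - Complex.I) fun z => by
        rw [eval_neg, Complex.exp_neg]; linear_combination h₂ z
    generalize Complex.exp a = A at *
    generalize Complex.exp b = B at *
    field_simp at e1 e2 e3
    -- Here `B² = -1` and `A = B⁻² = -1`, whereas `e1` then gives `B = -i/2`.
    have hB2 : B ^ 2 = -1 := by grind
    have hA : A = -1 := by grind
    grind

/-- If `g² + (Δk)² = 1` for entire functions of finite order on `ℂ`, then `g = cosh p` and
`i Δk = sinh p` for a polynomial `p`. -/
theorem exists_polynomial_exponent {g k : ℂ → ℂ} (hg : Differentiable ℂ g)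
    (hk : Differentiable ℂ k) (hg' : HasExpPowGrowth g) (hk' : HasExpPowGrowth k)
    (h : ∀ t, g t ^ 2 + (k (t + 1) - k t) ^ 2 = 1) :
    ∃ p : Polynomial ℂ, ∀ t,
      2 * g t = Complex.exp (p.eval t) + Complex.exp (-p.eval t) ∧
      2 * Complex.I * (k (t + 1) - k t) = Complex.exp (p.eval t) - Complex.exp (-p.eval t) := by
  have hI := Complex.I_sq
  have hmul : ∀ t, (g t + (Complex.I * k (t + 1) + -Complex.I * k t)) *
      (g t - Complex.I * (k (t + 1) - k t)) = 1 := fun t => by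
    linear_combination h t - (k (t + 1) - k t) ^ 2 * hI
  have hshift : HasExpPowGrowth fun t => k (t + 1) := hk'.comp 1 1 one_pos fun z => by
    simpa [add_comm] using norm_add_le z 1
  obtain ⟨p, hp⟩ := exists_eq_exp_polynomial (by fun_prop)
    (fun t => left_ne_zero_of_mul_eq_one (hmul t))
    (hg'.add ((hshift.const_mul Complex.I).add (hk'.const_mul (-Complex.I))))
  refine ⟨p, fun t => ?_⟩
  have h2 : g t - Complex.I * (k (t + 1) - k t) = Complex.exp (-p.eval t) := by
    rw [Complex.exp_neg, ← hp t]
    exact eq_inv_of_mul_eq_one_right (hmul t)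
  constructor
  · linear_combination hp t + h2
  · linear_combination hp t - h2

theorem constant_of_derivative_eq_zero {g : ℂ → ℂ} {p : Polynomial ℂ}
    (hp : Polynomial.derivative p = 0)
    (h : ∀ t, 2 * g t = Complex.exp (p.eval t) + Complex.exp (-p.eval t)) (t : ℂ) :
    g (t + 1) = g t := by
  have h1 := h (t + 1)
  have h2 := h t
  rw [Polynomial.eq_C_of_derivative_eq_zero hp] at h1 h2
  simp only [Polynomial.eval_C] at h1 h2
  linear_combination (h1 - h2) / 2

/-- A continuous function with square identically `1` on a preconnected space is constant. -/
theorem eq_of_sq_eq_one {X : Type*} [TopologicalSpace X] [PreconnectedSpace X] {f : X → ℂ}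
    (hf : Continuous f) (h : ∀ x, f x ^ 2 = 1) (x y : X) : f x = f y := by
  rcases isPreconnected_univ.eq_one_or_eq_neg_one_of_sq_eq hf.continuousOn
    (fun x _ => by simpa using h x) with h1 | h1 <;>
  simp [h1 (Set.mem_univ x), h1 (Set.mem_univ y)]

/-- One-variable case: finite order solutions on `ℂ` with shift `1` satisfy `g₁² = 1`. -/
theorem sq_eq_one_of_system {g₁ g₂ : ℂ → ℂ} (d₁ : Differentiable ℂ g₁) (d₂ : Differentiable ℂ g₂)
    (o₁ : HasExpPowGrowth g₁) (o₂ : HasExpPowGrowth g₂)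
    (h₁ : ∀ t, g₁ t ^ 2 + (g₂ (t + 1) - g₂ t) ^ 2 = 1)
    (h₂ : ∀ t, g₂ t ^ 2 + (g₁ (t + 1) - g₁ t) ^ 2 = 1) (t : ℂ) : g₁ t ^ 2 = 1 := by
  obtain ⟨p, hp⟩ := exists_polynomial_exponent d₁ d₂ o₁ o₂ h₁
  obtain ⟨q, hq⟩ := exists_polynomial_exponent d₂ d₁ o₂ o₁ h₂
  have of_shift : (∀ t, g₂ (t + 1) = g₂ t) → g₁ t ^ 2 = 1 := fun h => by
    simpa [h t] using h₁ t
  by_cases hq0 : Polynomial.derivative q = 0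
  · exact of_shift (constant_of_derivative_eq_zero hq0 fun t => (hq t).1)
  by_cases hp0 : Polynomial.derivative p = 0
  -- With `Δg₁ = 0` the second equation gives `g₂² = 1`, so `g₂` is constant and `Δg₂ = 0`.
  · have hc := constant_of_derivative_eq_zero hp0 fun t => (hp t).1
    exact of_shift fun s => eq_of_sq_eq_one d₂.continuous
      (fun x => by simpa [hc x] using h₂ x) _ _
  have hI := Complex.I_sq
  refine (not_exists_polynomial_exponents hp0 hq0 (fun z => ?_) fun z => ?_).elim
  · linear_combination (hp z).1 - (hp (z + 1)).1 - Complex.I * (hq z).2 +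
      2 * (g₁ (z + 1) - g₁ z) * hI
  · linear_combination (hq z).1 - (hq (z + 1)).1 - Complex.I * (hp z).2 +
      2 * (g₂ (z + 1) - g₂ z) * hI

/-! ### Reduction to complex lines -/

theorem theorem1p1 (c : CTwo) :
    ¬ ∃ f₁ f₂ : CTwo → ℂ,
      (IsTranscendentalEntire f₁ ∧ HasFiniteOrder f₁) ∧
      (IsTranscendentalEntire f₂ ∧ HasFiniteOrder f₂) ∧
      (∀ z : CTwo, f₁ z ^ 2 + differenceOp c f₂ z ^ 2 = 1) ∧
      (∀ z : CTwo, f₂ z ^ 2 + differenceOp c f₁ z ^ 2 = 1) := by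
  rintro ⟨f₁, f₂, ⟨⟨d₁, n₁⟩, o₁⟩, ⟨⟨d₂, -⟩, o₂⟩, h₁, h₂⟩
  refine n₁ ⟨MvPolynomial.C (f₁ 0), fun z => ?_⟩
  rw [MvPolynomial.eval_C]
  refine eq_of_sq_eq_one d₁.continuous (fun w => ?_) z 0
  have hline : Differentiable ℂ fun t : ℂ => w + t • c := by fun_prop
  -- The `+ 1` keeps the slope positive when `c = 0`.
  have hbound : ∀ t : ℂ, ‖w + t • c‖ ≤ ‖w‖ + (‖c‖ + 1) * ‖t‖ := fun t => by
    have := norm_add_le w (t • c)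
    rw [norm_smul] at this
    linarith [norm_nonneg t]
  have hstep : ∀ t : ℂ, w + (t + 1) • c = w + t • c + c := fun t => by
    rw [add_smul, one_smul, add_assoc]
  have := sq_eq_one_of_system (d₁.comp hline) (d₂.comp hline)
    ((o₁.hasExpPowGrowth d₁.continuous).comp _ _ (by positivity) hbound)
    ((o₂.hasExpPowGrowth d₂.continuous).comp _ _ (by positivity) hbound)
    (fun t => by simpa only [Function.comp, hstep, differenceOp] using h₁ (w + t • c))
    (fun t => by simpa only [Function.comp, hstep, differenceOp] using h₂ (w + t • c)) 0
  simpa using this
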